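/- Let $k$ be a field of characteristic different from $2$, let $n\ge 3$ be an integer, and suppose that $k$ contains a primitive $n$-th root of unity $\varepsilon$. For $N\ge 2$, in the polynomial ring $S_N=k[x_0,\dots,x_N]$ put $$F_{N,n}=\prod_{0\le i<j\le N}(x_i^n-x_j^n)$$ and $$I_{N,n}=\Bigl(\bigcap_{\substack{0\le i<j<l\le N\\ 0\le a,b<n}}(x_i-\varepsilon^a x_j,\ x_i-\varepsilon^b x_l)\Bigr)\cap\Bigl(\bigcap_{0\le i<j\le N}(x_i,x_j)\Bigr)$$ (the ideal of the union of the codimension-two flats in which at least three of the hyperplanes given by the linear factors of $F_{N,n}$ meet). For an ideal $I$ of a Noetherian ring $R$, let $I^{(r)}=\bigcap_{p\in\operatorname{Ass}(R/I)}(I^rR_p\cap R)$ denote its $r$-th symbolic power. Then, for every $N\ge 2$, $$F_{N,n}\in I_{N,n}^{(3)}\quad\text{and}\quad F_{N,n}\notin I_{N,n}^2;$$ in particular $I_{N,n}^{(3)}\not\subseteq I_{N,n}^2$. -/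

import Mathlib

namespace FermatArrangement

/-- The `r`-th symbolic power of an ideal `I` of `R`: the intersection, over the associated primes
`p` of `R ⧸ I`, of the contractions to `R` of the extended ideals `I ^ r R_p`. -/
def symbolicPower {R : Type*} [CommRing R] (I : Ideal R) (r : ℕ) : Ideal R :=
  ⨅ (p : Ideal R) (hp : p ∈ associatedPrimes R (R ⧸ I)),
    haveI : p.IsPrime := IsAssociatedPrime.isPrime hp
    ((I ^ r).map (algebraMap R (Localization.AtPrime p))).comap
      (algebraMap R (Localization.AtPrime p))

/-- The product `∏_{0 ≤ i < j ≤ N} (x_i ^ n - x_j ^ n)` in `k[x_0, …, x_N]`. -/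
noncomputable def fermatPoly (k : Type*) [Field k] (N n : ℕ) : MvPolynomial (Fin (N + 1)) k :=
  ∏ i : Fin (N + 1), ∏ j ∈ Finset.Ioi i,
    (MvPolynomial.X i ^ n - MvPolynomial.X j ^ n)

/-- The intersection of the ideals `(x_i, x_j)`, `0 ≤ i < j ≤ N`. -/
noncomputable def coordIdeal (k : Type*) [Field k] (N : ℕ) : Ideal (MvPolynomial (Fin (N + 1)) k) :=
  ⨅ (i : Fin (N + 1)) (j : Fin (N + 1)) (_ : i < j),
    Ideal.span {MvPolynomial.X i, MvPolynomial.X j}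

/-- The intersection of the ideals `(x_i - ε ^ a x_j, x_i - ε ^ b x_l)`,
`0 ≤ i < j < l ≤ N`, `0 ≤ a, b < n`. -/
noncomputable def tripleIdeal {k : Type*} [Field k] (N n : ℕ) (ε : k) :
    Ideal (MvPolynomial (Fin (N + 1)) k) :=
  ⨅ (i : Fin (N + 1)) (j : Fin (N + 1)) (l : Fin (N + 1)) (_ : i < j) (_ : j < l)
    (a : Fin n) (b : Fin n),
    Ideal.span
      {MvPolynomial.X i - MvPolynomial.C (ε ^ (a : ℕ)) * MvPolynomial.X j,
        MvPolynomial.X i - MvPolynomial.C (ε ^ (b : ℕ)) * MvPolynomial.X l}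

/-- The ideal of the codimension-two flats in which at least three hyperplanes of the Fermat
arrangement meet. -/
noncomputable def fermatIdeal {k : Type*} [Field k] (N n : ℕ) (ε : k) :
    Ideal (MvPolynomial (Fin (N + 1)) k) :=
  tripleIdeal N n ε ⊓ coordIdeal k N

end FermatArrangement

/-! The flats are distinct primes of height two, hence an antichain, so an element lying in `P ^ 3`
for every flat `P` lies in the symbolic cube (`mem_symbolicPower_sInf`). Three factors of F vanish
on each triple flat, and one factor lies in the n-th power of each coordinate flat
(`fermatPoly_mem_pow_three`).

For the ordinary square, write x, y, z for the first three variables and treat the others as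
coefficients. Vanishing on the n² lines through (1, ε^{-a}, ε^{-b}) and on the coordinate flats
forces linear relations on coefficients (`flatRelations_splitVars`). They make the coefficients of
x^n y^{2n} and x^n z^{2n} agree on every product of two elements of the ideal
(`FlatRelations.coeff_mul_eq`), hence on its square. For F these coefficients are -c and c with c ≠
0, and 2 ≠ 0. -/

namespace FermatArrangement

open MvPolynomial

/-! ### Symbolic powers of finite intersections of primes. -/

section SymbolicPower

variable {R : Type*} [CommRing R]

/-- An associated prime of a finite intersection of primes is one of these primes. -/
theorem mem_of_mem_associatedPrimes_sInf [IsNoetherianRing R] {S : Set (Ideal R)} (hS : S.Finite)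
    (hprime : ∀ P ∈ S, P.IsPrime) {p : Ideal R} (hp : p ∈ associatedPrimes R (R ⧸ sInf S)) :
    p ∈ S := by
  rw [AssociatedPrimes.mem_iff, isAssociatedPrime_iff] at hp
  obtain ⟨hpp, y, hy⟩ := hp
  obtain ⟨x, rfl⟩ := Ideal.Quotient.mk_surjective y
  have hmem : ∀ r, r ∈ p ↔ ∀ P ∈ S, r * x ∈ P := by
    intro r
    rw [hy, Submodule.mem_colon_singleton, Submodule.mem_bot, ← Submodule.mem_sInf,
      ← Ideal.Quotient.eq_zero_iff_mem, map_mul]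
    rfl
  -- As the annihilator of the class of `x`, `p` is the intersection of the primes in `T`; being
  -- prime, it equals one of them.
  set T := {P ∈ S | x ∉ P}
  have hT : T.Finite := hS.subset fun _ h => h.1
  have hle : hT.toFinset.inf id ≤ p := by
    intro r hr
    rw [hmem]
    intro P hP
    by_cases hx : x ∈ P
    · exact P.mul_mem_left r hx
    · have : hT.toFinset.inf id ≤ P := Finset.inf_le (f := id) (hT.mem_toFinset.2 ⟨hP, hx⟩)
      exact P.mul_mem_right x (this hr)
  obtain ⟨P, hPT, hPp⟩ := (Ideal.IsPrime.inf_le' hpp).1 hle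
  rw [hT.mem_toFinset] at hPT
  have hpP : p ≤ P := fun r hr =>
    ((hprime P hPT.1).mem_or_mem ((hmem r).1 hr P hPT.1)).resolve_right hPT.2
  exact le_antisymm hpP hPp ▸ hPT.1

/-- An element of all the powers `P ^ r`, where `P` runs through a finite antichain of primes, lies
in the `r`-th symbolic power of the intersection. -/
theorem mem_symbolicPower_sInf [IsNoetherianRing R] {S : Set (Ideal R)} (hS : S.Finite)
    (hprime : ∀ P ∈ S, P.IsPrime) (hanti : IsAntichain (· ≤ ·) S) {r : ℕ} {x : R}
    (hx : ∀ P ∈ S, x ∈ P ^ r) : x ∈ symbolicPower (sInf S) r := by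
  rw [symbolicPower]
  simp only [Submodule.mem_iInf]
  intro p hp
  have hpS := mem_of_mem_associatedPrimes_sInf hS hprime hp
  have hpp := hprime p hpS
  have hT : (S \ {p}).Finite := hS.subset Set.sdiff_subset
  have hnot : ¬ hT.toFinset.inf id ≤ p := by
    intro h
    obtain ⟨Q, hQ, hQp⟩ := (Ideal.IsPrime.inf_le' hpp).1 h
    rw [hT.mem_toFinset] at hQ
    exact hanti hQ.1 hpS hQ.2 hQp
  -- `s` lies in every other prime of `S`, so `s * p` is in the intersection, while `s ^ r` becomes
  -- a unit at `p`.
  obtain ⟨s, hs, hsp⟩ := SetLike.not_le_iff_exists.1 hnot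
  have hmul : Ideal.span {s} * p ≤ sInf S := by
    rw [Ideal.span_singleton_mul_le_iff]
    intro y hy
    rw [Submodule.mem_sInf]
    intro Q hQ
    by_cases hQp : Q = p
    · subst hQp
      exact Ideal.mul_mem_left _ s hy
    · have : hT.toFinset.inf id ≤ Q := Finset.inf_le (f := id) (hT.mem_toFinset.2 ⟨hQ, hQp⟩)
      exact Ideal.mul_mem_right y _ (this hs)
  have hsx : s ^ r * x ∈ sInf S ^ r := by
    have h := Ideal.pow_right_mono hmul r
    rw [mul_pow] at h
    exact h (Ideal.mul_mem_mul (Ideal.pow_mem_pow (Ideal.mem_span_singleton_self s) r) (hx p hpS))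
  rw [Ideal.mem_comap]
  have hunit := IsLocalization.map_units (Localization.AtPrime p)
    (⟨s ^ r, p.primeCompl.pow_mem hsp r⟩ : p.primeCompl)
  rw [← Ideal.unit_mul_mem_iff_mem _ hunit, ← map_mul]
  exact Ideal.mem_map_of_mem _ hsx

end SymbolicPower

/-! ### Primality and height of codimension-two flats. -/

section Flats

variable {k σ : Type*} [Field k]

/-- The substitution of `c x_w` for `x_u`. -/
noncomputable def substHom [DecidableEq σ] (u w : σ) (c : k) :
    MvPolynomial σ k →ₐ[k] MvPolynomial σ k :=
  aeval (Function.update X u (C c * X w))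

/-- The ideal of the flat `x_u = c x_w`, `x_v = d x_w`. -/
noncomputable def flatIdeal (u v w : σ) (c d : k) : Ideal (MvPolynomial σ k) :=
  Ideal.span {X u - C c * X w, X v - C d * X w}

/-- An endomorphism that is the identity modulo `P` and kills the generators of `P` has
kernel `P`. -/
theorem ker_eq_span {φ : MvPolynomial σ k →ₐ[k] MvPolynomial σ k} {s : Set (MvPolynomial σ k)}
    (hs : ∀ p ∈ s, φ p = 0) (hX : ∀ i, X i - φ (X i) ∈ Ideal.span s) :
    RingHom.ker φ = Ideal.span s := by
  apply le_antisymm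
  · intro p hp
    rw [RingHom.mem_ker] at hp
    have h : (Ideal.Quotient.mkₐ k (Ideal.span s)).comp φ = Ideal.Quotient.mkₐ k (Ideal.span s) := by
      ext i
      simp only [AlgHom.comp_apply, Ideal.Quotient.mkₐ_eq_mk]
      exact (Ideal.Quotient.eq.2 (hX i)).symm
    have := DFunLike.congr_fun h p
    simp only [AlgHom.comp_apply, hp, map_zero, Ideal.Quotient.mkₐ_eq_mk] at this
    exact Ideal.Quotient.eq_zero_iff_mem.1 this.symm
  · rw [Ideal.span_le]
    exact hs

theorem isPrime_span_of_retraction {φ : MvPolynomial σ k →ₐ[k] MvPolynomial σ k}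
    {s : Set (MvPolynomial σ k)} (hs : ∀ p ∈ s, φ p = 0)
    (hX : ∀ i, X i - φ (X i) ∈ Ideal.span s) : (Ideal.span s).IsPrime :=
  ker_eq_span hs hX ▸ RingHom.ker_isPrime φ

theorem isPrime_span_linear [DecidableEq σ] {u w : σ} (huw : u ≠ w) (c : k) :
    (Ideal.span {(X u - C c * X w : MvPolynomial σ k)}).IsPrime := by
  apply isPrime_span_of_retraction (φ := substHom u w c)
  · simp [substHom, algHom_C, huw.symm]
  · intro i
    by_cases hi : i = u
    · subst hi
      simp [substHom]
    · simp [substHom, hi]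

theorem isPrime_flatIdeal {u v w : σ} (huv : u ≠ v) (huw : u ≠ w) (hvw : v ≠ w) (c d : k) :
    (flatIdeal u v w c d).IsPrime := by
  classical
  apply isPrime_span_of_retraction
    (φ := aeval (Function.update (Function.update X u (C c * X w)) v (C d * X w)))
  · simp [algHom_C, huw.symm, hvw.symm, huv]
  · intro i
    by_cases hv : i = v
    · subst hv
      simpa using Ideal.subset_span (by simp)
    by_cases hu : i = u
    · subst hu
      simpa [hv] using Ideal.subset_span (by simp)
    · simp [hu, hv]

theorem two_le_height_flatIdeal {u v w : σ} (huv : u ≠ v) (huw : u ≠ w) (hvw : v ≠ w)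
    (c d : k) : 2 ≤ (flatIdeal u v w c d).height := by
  classical
  have h1 := isPrime_span_linear huw c
  have h2 := isPrime_flatIdeal huv huw hvw c d
  have hX {a b : σ} (hab : a ≠ b) (e : k) : (X a - C e * X b : MvPolynomial σ k) ≠ 0 := by
    intro h
    have := congrArg (eval (Function.update (0 : σ → k) a 1)) h
    simp [hab.symm] at this
  have hlt1 : (⊥ : Ideal (MvPolynomial σ k)) < Ideal.span {X u - C c * X w} := by
    rw [bot_lt_iff_ne_bot, Ne, Ideal.span_singleton_eq_bot]
    exact hX huw c
  have hlt2 : Ideal.span {X u - C c * X w} < flatIdeal u v w c d := by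
    refine lt_of_le_of_ne (Ideal.span_mono (by simp)) fun h => ?_
    have hmem : X v - C d * X w ∈ Ideal.span {(X u - C c * X w : MvPolynomial σ k)} := by
      rw [h]
      exact Ideal.subset_span (by simp)
    obtain ⟨q, hq⟩ := Ideal.mem_span_singleton.1 hmem
    -- The substitution kills the first generator but fixes the nonzero second one.
    have := congrArg (substHom u w c) hq
    simp only [map_mul, map_sub, substHom, aeval_X, algHom_C] at this
    simp [huw.symm, huv.symm, sub_eq_zero] at this
    exact hX hvw d (sub_eq_zero.2 this)
  have e1 := Ideal.height_add_one_le_of_lt_of_isPrime hlt1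
  have e2 := Ideal.height_add_one_le_of_lt_of_isPrime hlt2
  calc (2 : ℕ∞) = 0 + 1 + 1 := by norm_num
    _ ≤ (⊥ : Ideal (MvPolynomial σ k)).height + 1 + 1 := by gcongr; exact zero_le
    _ ≤ _ := (add_le_add_left e1 1).trans e2

/-- Krull's height theorem bounds the height of the larger prime by two, and the smaller one already
has height at least two. -/
theorem flatIdeal_eq_of_le [Finite σ] {u v w u' v' w' : σ} {c d c' d' : k}
    (huv : u ≠ v) (huw : u ≠ w) (hvw : v ≠ w) (huv' : u' ≠ v') (huw' : u' ≠ w') (hvw' : v' ≠ w')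
    (h : flatIdeal u v w c d ≤ flatIdeal u' v' w' c' d') :
    flatIdeal u v w c d = flatIdeal u' v' w' c' d' := by
  have h1 := isPrime_flatIdeal huv huw hvw c d
  have h2 := isPrime_flatIdeal huv' huw' hvw' c' d'
  have hle : (flatIdeal u' v' w' c' d').height ≤ 2 := by
    refine (Ideal.height_le_card_of_mem_minimalPrimes_span
      (s := {X u' - C c' * X w', X v' - C d' * X w'}) (Set.toFinite _) ?_).trans ?_
    · change _ ∈ (flatIdeal u' v' w' c' d').minimalPrimes
      rw [Ideal.minimalPrimes_eq_subsingleton_self]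
      rfl
    · exact_mod_cast (Set.ncard_insert_le _ _).trans (by simp)
  exact Ideal.eq_of_le_of_height_le _ h (hle.trans (two_le_height_flatIdeal huv huw hvw c d))

end Flats

/-! ### Membership in the symbolic cube. -/

section SymbolicCube

variable {k : Type*} [Field k] {N n : ℕ} {ε : k}

/-- The ideals of the flats whose intersection is `fermatIdeal N n ε`. -/
def flats (N n : ℕ) (ε : k) : Set (Ideal (MvPolynomial (Fin (N + 1)) k)) :=
  {P | ∃ i j l : Fin (N + 1), i < j ∧ j < l ∧ ∃ a b : Fin n, P = Ideal.span
      {X i - C (ε ^ (a : ℕ)) * X j, X i - C (ε ^ (b : ℕ)) * X l}} ∪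
    {P | ∃ i j : Fin (N + 1), i < j ∧ P = Ideal.span {X i, X j}}

theorem sInf_flats : sInf (flats N n ε) = fermatIdeal N n ε := by
  rw [flats, sInf_union, fermatIdeal]
  congr 1
  · apply le_antisymm
    · simp only [tripleIdeal, le_iInf_iff]
      intro i j l hij hjl a b
      exact sInf_le ⟨i, j, l, hij, hjl, a, b, rfl⟩
    · refine le_sInf ?_
      rintro P ⟨i, j, l, hij, hjl, a, b, rfl⟩
      exact (iInf₂_le_of_le i j (iInf₂_le_of_le l hij (iInf₂_le_of_le hjl a (iInf_le _ b))))
  · apply le_antisymm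
    · simp only [coordIdeal, le_iInf_iff]
      intro i j hij
      exact sInf_le ⟨i, j, hij, rfl⟩
    · refine le_sInf ?_
      rintro P ⟨i, j, hij, rfl⟩
      exact iInf₂_le_of_le i j (iInf_le _ hij)

theorem finite_flats : (flats N n ε).Finite := by
  refine Set.Finite.union ?_ ?_
  · refine (Set.finite_range fun x : Fin (N + 1) × Fin (N + 1) × Fin (N + 1) × Fin n × Fin n =>
      Ideal.span {(X x.1 - C (ε ^ (x.2.2.2.1 : ℕ)) * X x.2.1 : MvPolynomial (Fin (N + 1)) k),
        X x.1 - C (ε ^ (x.2.2.2.2 : ℕ)) * X x.2.2.1}).subset ?_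
    rintro P ⟨i, j, l, -, -, a, b, rfl⟩
    exact ⟨(i, j, l, a, b), rfl⟩
  · refine (Set.finite_range fun x : Fin (N + 1) × Fin (N + 1) =>
      Ideal.span {(X x.1 : MvPolynomial (Fin (N + 1)) k), X x.2}).subset ?_
    rintro P ⟨i, j, -, rfl⟩
    exact ⟨(i, j), rfl⟩

/-- A common shape for both families: a triple flat is parametrized by its first variable, and a
coordinate flat has `c = d = 0` with any third index as `w`. -/
theorem exists_flatIdeal (hε : ε ≠ 0) (hN : 2 ≤ N) {P : Ideal (MvPolynomial (Fin (N + 1)) k)}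
    (hP : P ∈ flats N n ε) : ∃ (u v w : Fin (N + 1)) (c d : k), u ≠ v ∧ u ≠ w ∧ v ≠ w ∧
      P = flatIdeal u v w c d := by
  rcases hP with ⟨i, j, l, hij, hjl, a, b, rfl⟩ | ⟨i, j, hij, rfl⟩
  · refine ⟨j, l, i, (ε ^ (a : ℕ))⁻¹, (ε ^ (b : ℕ))⁻¹, hjl.ne, hij.ne', (hij.trans hjl).ne', ?_⟩
    have key (c : k) (hc : c ≠ 0) (u v : Fin (N + 1)) :
        Ideal.span {(X u - C c * X v : MvPolynomial (Fin (N + 1)) k)} =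
          Ideal.span {X v - C c⁻¹ * X u} := by
      have hmul : (C c * C c⁻¹ : MvPolynomial (Fin (N + 1)) k) = 1 := by
        rw [← C_mul, mul_inv_cancel₀ hc, C_1]
      apply le_antisymm <;> rw [Ideal.span_singleton_le_span_singleton]
      · exact ⟨-C c, by linear_combination (-X u) * hmul⟩
      · exact ⟨-C c⁻¹, by linear_combination (-X v) * hmul⟩
    rw [flatIdeal, Ideal.span_insert, Ideal.span_insert, key _ (pow_ne_zero _ hε),
      key _ (pow_ne_zero _ hε)]
  · obtain ⟨w, -, hw⟩ := Finset.exists_mem_notMem_of_card_lt_card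
      (s := {i, j}) (t := (Finset.univ : Finset (Fin (N + 1))))
      (Finset.card_le_two.trans_lt (by simp; omega))
    simp only [Finset.mem_insert, Finset.mem_singleton, not_or] at hw
    exact ⟨i, j, w, 0, 0, hij.ne, Ne.symm hw.1, Ne.symm hw.2, by simp [flatIdeal]⟩

theorem X_pow_sub_X_pow_dvd_fermatPoly {i j : Fin (N + 1)} (hij : i < j) :
    (X i ^ n - X j ^ n) ∣ fermatPoly k N n :=
  (Finset.dvd_prod_of_mem (fun j => X i ^ n - X j ^ n) (Finset.mem_Ioi.2 hij)).trans
    (Finset.dvd_prod_of_mem (fun i => ∏ j ∈ Finset.Ioi i, (X i ^ n - X j ^ n)) (Finset.mem_univ i))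

theorem three_factors_dvd_fermatPoly {i j l : Fin (N + 1)} (hij : i < j) (hjl : j < l) :
    (X i ^ n - X j ^ n) * ((X i ^ n - X l ^ n) * (X j ^ n - X l ^ n)) ∣ fermatPoly k N n := by
  rw [fermatPoly, Finset.prod_sigma']
  have hsub : ({⟨i, j⟩, ⟨i, l⟩, ⟨j, l⟩} : Finset (Σ _ : Fin (N + 1), Fin (N + 1))) ⊆
      Finset.univ.sigma fun i => Finset.Ioi i := by
    intro x
    simp only [Finset.mem_insert, Finset.mem_singleton, Finset.mem_sigma, Finset.mem_univ,
      Finset.mem_Ioi, true_and]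
    rintro (rfl | rfl | rfl)
    exacts [hij, hij.trans hjl, hjl]
  refine dvd_trans (dvd_of_eq ?_) (Finset.prod_dvd_prod_of_subset _ _ _ hsub)
  rw [Finset.prod_insert, Finset.prod_insert, Finset.prod_singleton]
  · simp [hij.ne]
  · simp [hij.ne, hjl.ne]

theorem X_pow_sub_X_pow_mem {σ : Type*} {c : k} (hc : c ^ n = 1) {P : Ideal (MvPolynomial σ k)}
    {u v : σ} (h : X u - C c * X v ∈ P) : X u ^ n - X v ^ n ∈ P := by
  have h1 : (X u ^ n - X v ^ n : MvPolynomial σ k) = X u ^ n - (C c * X v) ^ n := by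
    rw [mul_pow, ← C_pow, hc, C_1, one_mul]
  rw [h1]
  exact P.mem_of_dvd (sub_dvd_pow_sub_pow _ _ n) h

theorem fermatPoly_mem_pow_three (hn : 3 ≤ n) (hε : ε ^ n = 1)
    {P : Ideal (MvPolynomial (Fin (N + 1)) k)} (hP : P ∈ flats N n ε) :
    fermatPoly k N n ∈ P ^ 3 := by
  rcases hP with ⟨i, j, l, hij, hjl, a, b, hP⟩ | ⟨i, j, hij, hP⟩
  · refine Ideal.mem_of_dvd _ (three_factors_dvd_fermatPoly hij hjl) ?_
    have hroot (a : ℕ) : (ε ^ a) ^ n = 1 := by rw [← pow_mul, mul_comm, pow_mul, hε, one_pow]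
    have hj : X i ^ n - X j ^ n ∈ P :=
      X_pow_sub_X_pow_mem (hroot a) (hP ▸ Ideal.subset_span (by simp))
    have hl : X i ^ n - X l ^ n ∈ P :=
      X_pow_sub_X_pow_mem (hroot b) (hP ▸ Ideal.subset_span (by simp))
    have hjl : X j ^ n - X l ^ n ∈ P := by
      convert P.sub_mem hl hj using 1
      ring
    rw [pow_succ', pow_two]
    exact Ideal.mul_mem_mul hj (Ideal.mul_mem_mul hl hjl)
  · refine Ideal.mem_of_dvd _ (X_pow_sub_X_pow_dvd_fermatPoly hij) (Ideal.pow_le_pow_right hn ?_)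
    rw [hP]
    exact Ideal.sub_mem _ (Ideal.pow_mem_pow (Ideal.subset_span (by simp)) n)
      (Ideal.pow_mem_pow (Ideal.subset_span (by simp)) n)

theorem fermatPoly_mem_symbolicPower (hn : 3 ≤ n) (hε : IsPrimitiveRoot ε n) (hN : 2 ≤ N) :
    fermatPoly k N n ∈ symbolicPower (fermatIdeal N n ε) 3 := by
  have h0 : ε ≠ 0 := hε.ne_zero (by omega)
  rw [← sInf_flats]
  refine mem_symbolicPower_sInf finite_flats ?_ ?_ fun P =>
    fermatPoly_mem_pow_three hn hε.pow_eq_one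
  · intro P hP
    obtain ⟨u, v, w, c, d, huv, huw, hvw, rfl⟩ := exists_flatIdeal h0 hN hP
    exact isPrime_flatIdeal huv huw hvw c d
  · intro P hP Q hQ hne hle
    obtain ⟨u, v, w, c, d, huv, huw, hvw, rfl⟩ := exists_flatIdeal h0 hN hP
    obtain ⟨u', v', w', c', d', huv', huw', hvw', rfl⟩ := exists_flatIdeal h0 hN hQ
    exact hne (flatIdeal_eq_of_le huv huw hvw huv' huw' hvw' hle)

end SymbolicCube

/-! ### A coefficient identity on the square of the ideal. -/

section OrdinarySquare

/-- The exponent of `x ^ i y ^ j z ^ l`. -/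
noncomputable def expo (i j l : ℕ) : Fin 3 →₀ ℕ :=
  Finsupp.equivFunOnFinite.symm ![i, j, l]

@[simp] theorem expo_apply_zero (i j l : ℕ) : expo i j l 0 = i := rfl
@[simp] theorem expo_apply_one (i j l : ℕ) : expo i j l 1 = j := rfl
@[simp] theorem expo_apply_two (i j l : ℕ) : expo i j l 2 = l := rfl

theorem eq_expo_iff {m : Fin 3 →₀ ℕ} {i j l : ℕ} :
    m = expo i j l ↔ m 0 = i ∧ m 1 = j ∧ m 2 = l := by
  constructor
  · rintro rfl
    simp
  · rintro ⟨rfl, rfl, rfl⟩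
    ext t
    fin_cases t <;> rfl

theorem expo_le_iff {i j l i' j' l' : ℕ} :
    expo i j l ≤ expo i' j' l' ↔ i ≤ i' ∧ j ≤ j' ∧ l ≤ l' := by
  rw [Finsupp.le_def, Fin.forall_fin_succ, Fin.forall_fin_two]
  rfl

variable {B : Type*} [CommRing B]

theorem X_pow_mul_X_pow_mul_X_pow (i j l : ℕ) :
    (X 0 ^ i * X 1 ^ j * X 2 ^ l : MvPolynomial (Fin 3) B) = monomial (expo i j l) 1 := by
  rw [monomial_eq, Finsupp.prod_fintype _ _ (by simp), Fin.prod_univ_three]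
  simp

/-- The relations on the coefficients of a polynomial vanishing on the flats of the Fermat
arrangement in three variables that are used to bound the square of the ideal. -/
structure FlatRelations (n : ℕ) (f : MvPolynomial (Fin 3) B) : Prop where
  pure_one : ∀ j, coeff (expo 0 j 0) f = 0
  pure_two : ∀ l, coeff (expo 0 0 l) f = 0
  small_one : ∀ i < n, ∀ j < n, coeff (expo i j 0) f = 0
  small_two : ∀ i < n, ∀ l < n, coeff (expo i 0 l) f = 0
  alternating : ∀ i < n, coeff (expo i n 0) f + coeff (expo i 0 n) f = 0

/-- Swapping y and z matches the two convolution sums term by term. Terms with a pure power, or with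
a y-exponent below `n` in one factor, vanish; in the remaining ones both y-exponents are `n`, and
the two sign changes cancel. -/
theorem FlatRelations.coeff_mul_eq {n : ℕ} {f g : MvPolynomial (Fin 3) B}
    (hf : FlatRelations n f) (hg : FlatRelations n g) :
    coeff (expo n (2 * n) 0) (f * g) = coeff (expo n 0 (2 * n)) (f * g) := by
  rw [coeff_mul, coeff_mul]
  have hmem {a b c : ℕ} {x : (Fin 3 →₀ ℕ) × (Fin 3 →₀ ℕ)} :
      x ∈ Finset.HasAntidiagonal.antidiagonal (expo a b c) ↔
        x.1 0 + x.2 0 = a ∧ x.1 1 + x.2 1 = b ∧ x.1 2 + x.2 2 = c := by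
    rw [Finset.HasAntidiagonal.mem_antidiagonal, eq_expo_iff]
    rfl
  have hself (m : Fin 3 →₀ ℕ) : expo (m 0) (m 1) (m 2) = m := (eq_expo_iff.2 ⟨rfl, rfl, rfl⟩).symm
  refine Finset.sum_bij'
    (fun x _ => (expo (x.1 0) (x.1 2) (x.1 1), expo (x.2 0) (x.2 2) (x.2 1)))
    (fun x _ => (expo (x.1 0) (x.1 2) (x.1 1), expo (x.2 0) (x.2 2) (x.2 1))) ?_ ?_ ?_ ?_ ?_
  · intro x hx
    rw [hmem] at hx ⊢
    exact ⟨hx.1, hx.2.2, hx.2.1⟩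
  · intro x hx
    rw [hmem] at hx ⊢
    exact ⟨hx.1, hx.2.2, hx.2.1⟩
  · intro x _
    simp [hself]
  · intro x _
    simp [hself]
  · rintro ⟨u, v⟩ hx
    rw [hmem] at hx
    obtain ⟨h0, h1, h2⟩ := hx
    simp only at h0 h1 h2 ⊢
    obtain ⟨hu2, hv2⟩ : u 2 = 0 ∧ v 2 = 0 := by omega
    rw [← hself u, ← hself v]
    simp only [expo_apply_zero, expo_apply_one, expo_apply_two, hu2, hv2]
    generalize u 0 = i at *
    generalize v 0 = i' at *
    generalize u 1 = j at *
    generalize v 1 = j' at *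
    rcases Nat.eq_zero_or_pos i with rfl | hi
    · rw [hf.pure_one, hf.pure_two, zero_mul, zero_mul]
    rcases Nat.eq_zero_or_pos i' with rfl | hi'
    · rw [hg.pure_one, hg.pure_two, mul_zero, mul_zero]
    rcases lt_trichotomy j n with hj | rfl | hj
    · rw [hf.small_one i (by omega) j hj, hf.small_two i (by omega) j hj, zero_mul, zero_mul]
    · obtain rfl : j' = j := by omega
      rw [eq_neg_of_add_eq_zero_left (hf.alternating i (by omega)),
        eq_neg_of_add_eq_zero_left (hg.alternating i' (by omega)), neg_mul_neg]
    · rw [hg.small_one i' (by omega) j' (by omega), hg.small_two i' (by omega) j' (by omega),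
        mul_zero, mul_zero]

theorem coeff_eq_of_mem_sq {R : Type*} [CommRing R] {I : Ideal R} {n : ℕ}
    {φ : R →+* MvPolynomial (Fin 3) B} (hI : ∀ p ∈ I, FlatRelations n (φ p)) {p : R}
    (hp : p ∈ I ^ 2) :
    coeff (expo n (2 * n) 0) (φ p) = coeff (expo n 0 (2 * n)) (φ p) := by
  rw [pow_two] at hp
  refine Submodule.mul_induction_on hp ?_ ?_
  · intro a ha b hb
    rw [map_mul]
    exact (hI a ha).coeff_mul_eq (hI b hb)
  · intro a b ha hb
    rw [map_add, coeff_add, coeff_add, ha, hb]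

/-! ### Coefficient relations by averaging over roots of unity. -/

theorem sum_pow_pow_primitiveRoot [IsDomain B] {n : ℕ} {δ : B} (hδ : IsPrimitiveRoot δ n)
    (s : ℕ) : ∑ a ∈ Finset.range n, (δ ^ s) ^ a = if n ∣ s then (n : B) else 0 := by
  split_ifs with h
  · simp [(hδ.pow_eq_one_iff_dvd s).2 h]
  · have h1 : δ ^ s - 1 ≠ 0 := sub_ne_zero.2 fun h1 => h ((hδ.pow_eq_one_iff_dvd s).1 h1)
    refine (mul_eq_zero.1 ?_).resolve_left h1
    rw [mul_geom_sum, ← pow_mul, mul_comm, pow_mul, hδ.pow_eq_one, one_pow, sub_self]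

/-- Restriction of a polynomial in three variables to the line through `(1, y, z)`. -/
noncomputable def restrictLine (y z : B) : MvPolynomial (Fin 3) B →ₐ[B] Polynomial B :=
  aeval ![Polynomial.X, Polynomial.C y * Polynomial.X, Polynomial.C z * Polynomial.X]

theorem restrictLine_C (y z c : B) : restrictLine y z (C c) = Polynomial.C c := by
  rw [restrictLine, aeval_C]
  rfl

theorem coeff_restrictLine (y z : B) (f : MvPolynomial (Fin 3) B) (d : ℕ) :
    (restrictLine y z f).coeff d =
      ∑ m ∈ f.support, if m 0 + m 1 + m 2 = d then coeff m f * (y ^ m 1 * z ^ m 2) else 0 := by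
  rw [restrictLine, aeval_def, eval₂_eq', Polynomial.finsetSum_coeff]
  refine Finset.sum_congr rfl fun m _ => ?_
  have : (algebraMap B (Polynomial B)) (coeff m f) * ∏ i, (![Polynomial.X,
      Polynomial.C y * Polynomial.X, Polynomial.C z * Polynomial.X] : Fin 3 → Polynomial B) i ^ m i
      = Polynomial.C (coeff m f * (y ^ m 1 * z ^ m 2)) * Polynomial.X ^ (m 0 + m 1 + m 2) := by
    rw [Fin.prod_univ_three]
    simp only [Matrix.cons_val_zero, Matrix.cons_val_one, Matrix.cons_val, Polynomial.C_mul,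
      Polynomial.C_pow, Polynomial.algebraMap_eq]
    ring
  rw [this, Polynomial.coeff_C_mul_X_pow]
  simp only [eq_comm]

/-- Averaging over the lines through the points `(1, δ ^ a, δ ^ b)` isolates the coefficients of
fixed degree whose exponents lie in given residue classes. -/
theorem sum_coeff_eq_zero [IsDomain B] {n : ℕ} [NeZero n] {δ : B} (hδ : IsPrimitiveRoot δ n)
    {f : MvPolynomial (Fin 3) B} (hf : ∀ a < n, ∀ b < n, restrictLine (δ ^ a) (δ ^ b) f = 0)
    (d s t : ℕ) (T : Finset (Fin 3 →₀ ℕ))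
    (hT : ∀ m, m ∈ T ↔ m 0 + m 1 + m 2 = d ∧ n ∣ s + m 1 ∧ n ∣ t + m 2) :
    ∑ m ∈ T, coeff m f = 0 := by
  classical
  have hn : (n : B) ≠ 0 := hδ.neZero'.out
  -- The weight selects y-exponents congruent to `-s` and z-exponents congruent to `-t` modulo `n`,
  -- by orthogonality of characters.
  have h0 : ∑ a ∈ Finset.range n, ∑ b ∈ Finset.range n,
      δ ^ (a * s + b * t) * (restrictLine (δ ^ a) (δ ^ b) f).coeff d = 0 := by
    refine Finset.sum_eq_zero fun a ha => Finset.sum_eq_zero fun b hb => ?_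
    rw [hf a (Finset.mem_range.1 ha) b (Finset.mem_range.1 hb), Polynomial.coeff_zero, mul_zero]
  have h1 : ∑ a ∈ Finset.range n, ∑ b ∈ Finset.range n,
      δ ^ (a * s + b * t) * (restrictLine (δ ^ a) (δ ^ b) f).coeff d =
      ∑ m ∈ f.support, if m ∈ T then (n : B) ^ 2 * coeff m f else 0 := by
    simp only [coeff_restrictLine, Finset.mul_sum]
    rw [Finset.sum_congr rfl fun a _ => Finset.sum_comm, Finset.sum_comm]
    refine Finset.sum_congr rfl fun m _ => ?_
    have h2 : ∀ a b, (δ ^ (a * s + b * t) *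
        if m 0 + m 1 + m 2 = d then coeff m f * ((δ ^ a) ^ m 1 * (δ ^ b) ^ m 2) else 0) =
        (if m 0 + m 1 + m 2 = d then coeff m f else 0) *
          ((δ ^ (s + m 1)) ^ a * (δ ^ (t + m 2)) ^ b) := by
      intro a b
      split_ifs
      · ring
      · simp
    simp only [h2, ← Finset.mul_sum, ← Finset.sum_mul]
    rw [sum_pow_pow_primitiveRoot hδ, sum_pow_pow_primitiveRoot hδ]
    simp only [hT]
    split_ifs <;> first | tauto | ring
  rw [h1, ← Finset.sum_filter, ← Finset.mul_sum] at h0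
  have h2 := (mul_eq_zero.1 h0).resolve_left (pow_ne_zero 2 hn)
  rw [← h2]
  symm
  refine Finset.sum_subset (fun m hm => (Finset.mem_filter.1 hm).2) fun m hm hm' => ?_
  by_contra h
  exact hm' (Finset.mem_filter.2 ⟨mem_support_iff.2 h, hm⟩)

theorem coeff_eq_zero_of_mem_span_X {σ : Type*} {u v : σ} {f : MvPolynomial σ B}
    (hf : f ∈ Ideal.span {X u, X v}) {m : σ →₀ ℕ} (hu : m u = 0) (hv : m v = 0) :
    coeff m f = 0 := by
  rw [← Set.image_pair, mem_ideal_span_X_image] at hf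
  by_contra h
  obtain ⟨i, hi, hm⟩ := hf m (mem_support_iff.2 h)
  rcases hi with rfl | rfl
  exacts [hm hu, hm hv]

theorem flatRelations_of_vanishing [IsDomain B] {n : ℕ} [NeZero n] {δ : B}
    (hδ : IsPrimitiveRoot δ n) {f : MvPolynomial (Fin 3) B}
    (hf : ∀ a < n, ∀ b < n, restrictLine (δ ^ a) (δ ^ b) f = 0)
    (h01 : f ∈ Ideal.span {X 0, X 1}) (h02 : f ∈ Ideal.span {X 0, X 2})
    (h12 : f ∈ Ideal.span {X 1, X 2}) : FlatRelations n f where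
  pure_one i := coeff_eq_zero_of_mem_span_X h02 rfl rfl
  pure_two i := coeff_eq_zero_of_mem_span_X h01 rfl rfl
  small_one i hi j hj := by
    -- The shift `n - j` selects the residue class of `j`; as `i < n`, degree `i + j` leaves room
    -- for only one monomial.
    have h := sum_coeff_eq_zero hδ hf (i + j) (n - j) 0 {expo i j 0} ?_
    · simpa using h
    intro m
    rw [Finset.mem_singleton, eq_expo_iff]
    constructor
    · rintro ⟨rfl, rfl, h⟩
      simp [h, Nat.sub_add_cancel hj.le]
    · rintro ⟨hd, ⟨p, hp⟩, ⟨q, hq⟩⟩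
      have hp1 : 1 ≤ p := by
        rcases Nat.eq_zero_or_pos p with rfl | h <;> omega
      obtain ⟨p, rfl⟩ := Nat.exists_eq_add_of_le hp1
      have hp0 : n * (p + q) < n * 1 := by
        rw [mul_add] at *
        omega
      have := lt_of_mul_lt_mul_left hp0 (Nat.zero_le n)
      obtain ⟨rfl, rfl⟩ : p = 0 ∧ q = 0 := by omega
      omega
  small_two i hi j hj := by
    have h := sum_coeff_eq_zero hδ hf (i + j) 0 (n - j) {expo i 0 j} ?_
    · simpa using h
    intro m
    rw [Finset.mem_singleton, eq_expo_iff]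
    constructor
    · rintro ⟨rfl, h, rfl⟩
      simp [h, Nat.sub_add_cancel hj.le]
    · rintro ⟨hd, ⟨q, hq⟩, ⟨p, hp⟩⟩
      have hp1 : 1 ≤ p := by
        rcases Nat.eq_zero_or_pos p with rfl | h <;> omega
      obtain ⟨p, rfl⟩ := Nat.exists_eq_add_of_le hp1
      have hp0 : n * (p + q) < n * 1 := by
        rw [mul_add] at *
        omega
      have := lt_of_mul_lt_mul_left hp0 (Nat.zero_le n)
      obtain ⟨rfl, rfl⟩ : p = 0 ∧ q = 0 := by omega
      omega
  alternating i hi := by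
    have hn : 0 < n := NeZero.pos n
    -- Below degree `2 * n`, only three monomials have y- and z-exponents divisible by `n`; the pure
    -- power of x drops out by `h12`.
    have h := sum_coeff_eq_zero hδ hf (i + n) 0 0
      {expo (i + n) 0 0, expo i n 0, expo i 0 n} ?_
    · rw [Finset.sum_insert, Finset.sum_pair, coeff_eq_zero_of_mem_span_X h12 rfl rfl,
        zero_add] at h
      · exact h
      · rw [Ne, eq_expo_iff]
        simp [hn.ne']
      · simp only [Finset.mem_insert, Finset.mem_singleton, eq_expo_iff]
        simp [hn.ne']
    intro m
    simp only [Finset.mem_insert, Finset.mem_singleton, eq_expo_iff]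
    constructor
    · rintro (⟨h0, h1, h2⟩ | ⟨h0, h1, h2⟩ | ⟨h0, h1, h2⟩) <;> simp [h0, h1, h2]
    · rintro ⟨hd, ⟨p, hp⟩, ⟨q, hq⟩⟩
      have hp0 : n * (p + q) < n * 2 := by
        rw [mul_add]
        omega
      have := lt_of_mul_lt_mul_left hp0 (Nat.zero_le n)
      obtain ⟨rfl, rfl⟩ | ⟨rfl, rfl⟩ | ⟨rfl, rfl⟩ :
          p = 0 ∧ q = 0 ∨ p = 1 ∧ q = 0 ∨ p = 0 ∧ q = 1 := by omega
      all_goals omega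

/-- Of the six monomials of this Vandermonde product, only the target monomial itself divides the
target. -/
theorem coeff_triple_product_mul {n : ℕ} (hn : 0 < n) (g : MvPolynomial (Fin 3) B) :
    coeff (expo n (2 * n) 0)
        ((X 0 ^ n - X 1 ^ n) * (X 0 ^ n - X 2 ^ n) * (X 1 ^ n - X 2 ^ n) * g) = -coeff 0 g ∧
      coeff (expo n 0 (2 * n))
        ((X 0 ^ n - X 1 ^ n) * (X 0 ^ n - X 2 ^ n) * (X 1 ^ n - X 2 ^ n) * g) = coeff 0 g := by
  have h : ((X 0 ^ n - X 1 ^ n) * (X 0 ^ n - X 2 ^ n) * (X 1 ^ n - X 2 ^ n) * g :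
      MvPolynomial (Fin 3) B) =
      monomial (expo (2 * n) n 0) 1 * g - monomial (expo (2 * n) 0 n) 1 * g -
      monomial (expo n (2 * n) 0) 1 * g + monomial (expo n 0 (2 * n)) 1 * g +
      monomial (expo 0 (2 * n) n) 1 * g - monomial (expo 0 n (2 * n)) 1 * g := by
    simp only [← X_pow_mul_X_pow_mul_X_pow]
    ring
  rw [h]
  constructor <;>
  · simp only [coeff_add, coeff_sub, coeff_monomial_mul', expo_le_iff]
    simp [hn.ne', show ¬ 2 * n ≤ n by omega]

/-! ### Reduction to three variables over a polynomial ring. -/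

variable {k : Type*} [Field k]

/-- The map `k[x_0, …, x_{M+2}] → k[x_3, …, x_{M+2}][x_0, x_1, x_2]`. -/
noncomputable def splitVars (k : Type*) [Field k] (M : ℕ) :
    MvPolynomial (Fin (M + 2 + 1)) k →ₐ[k] MvPolynomial (Fin 3) (MvPolynomial (Fin M) k) :=
  aeval (Fin.cons (X 0) (Fin.cons (X 1) (Fin.cons (X 2) fun m => C (X m))))

variable {M n : ℕ}

theorem splitVars_X_zero : splitVars k M (X 0) = X 0 := by
  rw [splitVars, aeval_X]; rfl

theorem splitVars_X_one : splitVars k M (X (Fin.succ 0)) = X 1 := by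
  rw [splitVars, aeval_X]; rfl

theorem splitVars_X_two : splitVars k M (X (Fin.succ (Fin.succ 0))) = X 2 := by
  rw [splitVars, aeval_X]; rfl

theorem splitVars_X_succ (m : Fin M) :
    splitVars k M (X m.succ.succ.succ) = C (X m) := by
  rw [splitVars, aeval_X]; rfl

theorem splitVars_C (c : k) : splitVars k M (C c) = C (C c) := by
  rw [splitVars, algHom_C]; rfl

theorem X_pow_ne_X_pow {σ : Type*} (hn : n ≠ 0) {i j : σ} (hij : i ≠ j) :
    (X i ^ n : MvPolynomial σ k) ≠ X j ^ n := by
  rw [X_pow_eq_monomial, X_pow_eq_monomial, Ne, monomial_left_inj one_ne_zero,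
    Finsupp.single_left_inj hn]
  exact hij

theorem exists_splitVars_fermatPoly (hn : n ≠ 0) :
    ∃ g, coeff 0 g ≠ 0 ∧ splitVars k M (fermatPoly k (M + 2) n) =
      (X 0 ^ n - X 1 ^ n) * (X 0 ^ n - X 2 ^ n) * (X 1 ^ n - X 2 ^ n) * g := by
  refine ⟨(∏ m : Fin M, (X 0 ^ n - C (X m) ^ n)) * (∏ m : Fin M, (X 1 ^ n - C (X m) ^ n)) *
    (∏ m : Fin M, (X 2 ^ n - C (X m) ^ n)) *
    ∏ i : Fin M, ∏ j ∈ Finset.Ioi i, (C (X i) ^ n - C (X j) ^ n), ?_, ?_⟩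
  · rw [← constantCoeff_eq]
    simp only [map_mul, map_prod, map_sub, map_pow, constantCoeff_X, constantCoeff_C, ne_eq,
      zero_pow hn, zero_sub, mul_eq_zero, Finset.prod_eq_zero_iff, not_or, not_exists, not_and,
      neg_eq_zero, pow_eq_zero_iff hn, X_ne_zero, Finset.mem_univ, Finset.mem_Ioi, sub_eq_zero]
    simp only [not_false_eq_true, implies_true, and_self, true_and, forall_const]
    exact fun i j hij => X_pow_ne_X_pow hn hij.ne
  · rw [fermatPoly]
    simp only [Fin.prod_univ_succ (n := M + 2), Fin.prod_univ_succ (n := M + 1),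
      Fin.prod_univ_succ (n := M), Fin.prod_Ioi_succ, Fin.prod_Ioi_zero, map_mul, map_prod, map_sub,
      map_pow, splitVars_X_zero, splitVars_X_one, splitVars_X_two, splitVars_X_succ]
    ring

theorem flatRelations_splitVars [NeZero n] {ε : k} (hε : IsPrimitiveRoot ε n)
    {p : MvPolynomial (Fin (M + 2 + 1)) k} (hp : p ∈ fermatIdeal (M + 2) n ε) :
    FlatRelations n (splitVars k M p) := by
  have h01 : (0 : Fin (M + 2 + 1)) < Fin.succ 0 := Fin.succ_pos _
  have h12 : (Fin.succ 0 : Fin (M + 2 + 1)) < Fin.succ (Fin.succ 0) :=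
    Fin.succ_lt_succ_iff.2 (Fin.succ_pos _)
  obtain ⟨htriple, hcoord⟩ := hp
  simp only [tripleIdeal, SetLike.mem_coe, Submodule.mem_iInf] at htriple
  simp only [coordIdeal, SetLike.mem_coe, Submodule.mem_iInf] at hcoord
  have hcoord' {i j : Fin (M + 2 + 1)} (hij : i < j) :
      splitVars k M p ∈ Ideal.span {splitVars k M (X i), splitVars k M (X j)} := by
    have := Ideal.mem_map_of_mem (splitVars k M) (hcoord i j hij)
    rwa [Ideal.map_span, Set.image_pair] at this
  -- The inverse appears because x = ε^a y means y = ε^{-a} x.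
  have hδ : IsPrimitiveRoot (C ε⁻¹ : MvPolynomial (Fin M) k) n :=
    hε.inv.map_of_injective (f := C) (C_injective _ _)
  refine flatRelations_of_vanishing hδ ?_ ?_ ?_ ?_
  · intro a ha b hb
    have h := htriple 0 (Fin.succ 0) (Fin.succ (Fin.succ 0)) h01 h12 ⟨a, ha⟩ ⟨b, hb⟩
    let φ := (restrictLine (B := MvPolynomial (Fin M) k) (C ε⁻¹ ^ a) (C ε⁻¹ ^ b)).toRingHom.comp (splitVars k M).toRingHom
    have hroot (c : ℕ) : (C (ε ^ c) : MvPolynomial (Fin M) k) * C ε⁻¹ ^ c = 1 := by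
      rw [← C_pow, ← C_mul, ← mul_pow, mul_inv_cancel₀ (hε.ne_zero (NeZero.ne n)), one_pow, C_1]
    have hle : Ideal.span {(X 0 - C (ε ^ a) * X (Fin.succ 0) : MvPolynomial (Fin (M + 2 + 1)) k),
        X 0 - C (ε ^ b) * X (Fin.succ (Fin.succ 0))} ≤ RingHom.ker φ := by
      have hker (c : ℕ) (t : Polynomial (MvPolynomial (Fin M) k)) :
          t - Polynomial.C (C (ε ^ c)) * (Polynomial.C (C ε⁻¹ ^ c) * t) = 0 := by
        rw [← mul_assoc, ← Polynomial.C_mul, hroot, Polynomial.C_1, one_mul, sub_self]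
      rw [Ideal.span_le]
      rintro q (rfl | rfl)
      · change restrictLine (B := MvPolynomial (Fin M) k) _ _ (splitVars k M _) = 0
        rw [map_sub, map_mul, splitVars_X_zero, splitVars_X_one, splitVars_C, map_sub, map_mul,
          restrictLine_C, restrictLine, aeval_X, aeval_X]
        exact hker a _
      · change restrictLine (B := MvPolynomial (Fin M) k) _ _ (splitVars k M _) = 0
        rw [map_sub, map_mul, splitVars_X_zero, splitVars_X_two, splitVars_C, map_sub, map_mul,
          restrictLine_C, restrictLine, aeval_X, aeval_X]
        exact hker b _
    exact hle h
  · have := hcoord' h01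
    rwa [splitVars_X_zero, splitVars_X_one] at this
  · have := hcoord' (h01.trans h12)
    rwa [splitVars_X_zero, splitVars_X_two] at this
  · have := hcoord' h12
    rwa [splitVars_X_one, splitVars_X_two] at this

theorem fermatPoly_notMem_sq (h2 : (2 : k) ≠ 0) [NeZero n] {ε : k} (hε : IsPrimitiveRoot ε n) :
    fermatPoly k (M + 2) n ∉ fermatIdeal (M + 2) n ε ^ 2 := by
  intro hmem
  have h := coeff_eq_of_mem_sq (φ := (splitVars k M).toRingHom)
    (fun p hp => flatRelations_splitVars hε hp) hmem
  obtain ⟨g, hg, hfac⟩ := exists_splitVars_fermatPoly (k := k) (M := M) (NeZero.ne n)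
  change coeff _ (splitVars k M _) = coeff _ (splitVars k M _) at h
  rw [hfac, (coeff_triple_product_mul (NeZero.pos n) g).1,
    (coeff_triple_product_mul (NeZero.pos n) g).2] at h
  have h2' : (2 : MvPolynomial (Fin M) k) ≠ 0 := by
    rw [← map_ofNat (C : k →+* MvPolynomial (Fin M) k) 2]
    exact (map_ne_zero_iff _ (C_injective _ _)).2 h2
  exact mul_ne_zero h2' hg (by linear_combination -h)

end OrdinarySquare
end FermatArrangement

theorem theorem1 {k : Type*} [Field k] (h2 : (2 : k) ≠ 0) (n : ℕ) (hn : 3 ≤ n)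
    (ε : k) (hε : IsPrimitiveRoot ε n) (N : ℕ) (hN : 2 ≤ N) :
    FermatArrangement.fermatPoly k N n ∈
        FermatArrangement.symbolicPower (FermatArrangement.fermatIdeal N n ε) 3 ∧
      FermatArrangement.fermatPoly k N n ∉ FermatArrangement.fermatIdeal N n ε ^ 2 ∧
      ¬ FermatArrangement.symbolicPower (FermatArrangement.fermatIdeal N n ε) 3 ≤
        FermatArrangement.fermatIdeal N n ε ^ 2 := by
  have hmem := FermatArrangement.fermatPoly_mem_symbolicPower hn hε hN
  obtain ⟨M, rfl⟩ := Nat.exists_eq_add_of_le' hN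
  have : NeZero n := ⟨by omega⟩
  have hnot := FermatArrangement.fermatPoly_notMem_sq (M := M) h2 hε
  exact ⟨hmem, hnot, fun h => hnot (h hmem)⟩
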